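/- Every irrational $x\in(0,1)$ has a unique infinite continued fraction expansion $$x=\cfrac{1}{a_1(x)+\cfrac{1}{a_2(x)+\cfrac{1}{a_3(x)+\cdots}}}$$ with positive integers $a_n(x)$, its partial quotients: $a_n(x)=\lfloor 1/T^{n-1}(x)\rfloor$, where $T(x)=1/x-\lfloor 1/x\rfloor$. Put $S_n(x)=\sum_{j=1}^n a_j(x)$. **Theorem.** Let $\gamma\in[1/2,1)$, let $\varphi(n)=\exp(n^\gamma)$, and let $$E_\varphi=\left\{x\in(0,1)\setminus\mathbb{Q}:\ \lim_{n\to\infty}\frac{S_n(x)}{\varphi(n)}=1\right\}.$$ Then the Hausdorff dimension of $E_\varphi$ is $\dim_H E_\varphi=\frac12$. -/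

import Mathlib

open Filter Topology

noncomputable section

/-- The Gauss map `T x = 1 / x (mod 1)`; since `0⁻¹ = 0`, also `T 0 = 0`. -/
def gaussMap (x : ℝ) : ℝ := Int.fract x⁻¹

/-- The `n`-th partial quotient `a_n(x) = ⌊1 / T^{n-1}(x)⌋`, `n ≥ 1`, of the continued fraction
expansion `x = [a_1(x), a_2(x), …]` of an irrational `x ∈ (0, 1)`. -/
def partialQuotient (x : ℝ) (n : ℕ) : ℕ := ⌊(gaussMap^[n - 1] x)⁻¹⌋₊

/-- `S_n(x) = a_1(x) + ⋯ + a_n(x)`. -/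
def sumPartialQuotients (x : ℝ) (n : ℕ) : ℕ := ∑ j ∈ Finset.Icc 1 n, partialQuotient x j

/-- The set `E_φ` of the irrational `x ∈ (0, 1)` with `S_n(x) / φ(n) → 1`. -/
def growthSet (φ : ℕ → ℝ) : Set ℝ :=
  {x | x ∈ Set.Ioo (0 : ℝ) 1 ∧ Irrational x ∧
    Tendsto (fun n : ℕ => (sumPartialQuotients x n : ℝ) / φ n) atTop (𝓝 1)}

end

open scoped ENNReal

/-! Upper bound. When `γ ≥ 1/2`, `n ^ γ` grows by at least a constant over a window of about `√n /
D` indices. Hence `S_n` grows by a definite factor there, and some digit in the window is at least a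
constant times `exp √n / √n` (`exists_large_digit_of_mem_growthSet`). In dimension `s = 1/2 + η`,
prescribing a digit `a` costs a factor `a ^ (-2s)`. Forcing one large digit among `L` costs at most
`L * tailWeight * totalWeight ^ L`; the tail decays like `exp (-η √n)` up to polynomial factors, and
a large `D` keeps `totalWeight ^ L` below `exp (η √n / 2)` up to a constant. The product tends to
`0`, and chaining windows gives measure zero (`hausdorffMeasure_eq_zero_of_large_digits`).

Lower bound. Take digits equal to the increments of `⌊exp (i ^ γ)⌋`, plus `2`, plus a free term of
size at most about `exp (θ i ^ γ)` with `θ < 1`. The sums telescope and the free terms are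
negligible. Coding the free terms by mixed-radix digits of `t ∈ [0, 1)` gives a map whose inverse is
`r`-Hölder when `2 r < θ`, so the dimension is at least `r`, for every `r < 1/2`
(`le_dimH_growthSet`). -/

/-! ### The Gauss map and its inverse branches -/

/-- The irrational points of the unit interval. -/
def unitIrrationals : Set ℝ := {x | x ∈ Set.Ioo (0 : ℝ) 1 ∧ Irrational x}

theorem gaussMap_mem_unitIrrationals {x : ℝ} (hx : x ∈ unitIrrationals) :
    gaussMap x ∈ unitIrrationals := by
  have hirr : Irrational (gaussMap x) := by
    unfold gaussMap Int.fract
    exact hx.2.inv.sub_intCast _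
  refine ⟨⟨lt_of_le_of_ne (Int.fract_nonneg _) ?_, Int.fract_lt_one _⟩, hirr⟩
  exact fun h => hirr.ne_zero h.symm

theorem iterate_gaussMap_mem_unitIrrationals {x : ℝ} (hx : x ∈ unitIrrationals) (n : ℕ) :
    gaussMap^[n] x ∈ unitIrrationals := by
  induction n with
  | zero => exact hx
  | succ n ih =>
    rw [Function.iterate_succ_apply']
    exact gaussMap_mem_unitIrrationals ih

theorem partialQuotient_iterate (x : ℝ) (k i : ℕ) :
    partialQuotient (gaussMap^[k] x) (i + 1) = partialQuotient x (k + i + 1) := by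
  simp only [partialQuotient, Nat.add_sub_cancel, ← Function.iterate_add_apply, add_comm]

/-- The inverse branch of the Gauss map with digit `a + 1`. -/
noncomputable def inverseBranch (a : ℕ) (x : ℝ) : ℝ := ((a : ℝ) + 1 + |x|)⁻¹

theorem exists_eq_inverseBranch {x : ℝ} (hx : x ∈ unitIrrationals) :
    ∃ a : ℕ, partialQuotient x 1 = a + 1 ∧ x = inverseBranch a (gaussMap x) := by
  have h1 : 1 ≤ x⁻¹ := (one_lt_inv₀ hx.1.1).2 hx.1.2 |>.le
  have h2 : 1 ≤ ⌊x⁻¹⌋₊ := Nat.le_floor (by simpa using h1)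
  refine ⟨⌊x⁻¹⌋₊ - 1, ?_, ?_⟩
  · simp only [partialQuotient, Nat.sub_self, Function.iterate_zero, id]
    omega
  · have h3 : ((⌊x⁻¹⌋₊ : ℕ) : ℝ) = ((⌊x⁻¹⌋ : ℤ) : ℝ) := natCast_floor_eq_intCast_floor (by linarith)
    rw [inverseBranch, abs_of_nonneg (Int.fract_nonneg _), Nat.cast_sub h2]
    unfold gaussMap Int.fract
    rw [h3, Nat.cast_one, sub_add_cancel, add_sub_cancel, inv_inv]

/-- Both denominators are at least `a + 1`. The absolute value in `inverseBranch` makes the bound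
global, so arbitrary covering sets can be pushed forward. -/
theorem lipschitzWith_inverseBranch (a : ℕ) :
    LipschitzWith (Real.toNNReal (((a : ℝ) + 1) ^ (-2 : ℝ))) (inverseBranch a) := by
  refine LipschitzWith.of_dist_le_mul fun x y => ?_
  have ha : (0 : ℝ) < (a : ℝ) + 1 := by positivity
  rw [Real.coe_toNNReal _ (by positivity), Real.dist_eq, Real.dist_eq, inverseBranch, inverseBranch,
    inv_sub_inv (by positivity) (by positivity), abs_div, Real.rpow_neg ha.le, Real.rpow_two,
    inv_mul_eq_div]
  have h1 : |(a : ℝ) + 1 + |y| - ((a : ℝ) + 1 + |x|)| ≤ |x - y| := by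
    rw [add_sub_add_left_eq_sub, abs_sub_comm x y]
    exact abs_abs_sub_abs_le _ _
  have h2 : ((a : ℝ) + 1) ^ 2 ≤ |((a : ℝ) + 1 + |x|) * ((a : ℝ) + 1 + |y|)| := by
    rw [abs_of_pos (by positivity)]
    nlinarith [abs_nonneg x, abs_nonneg y, mul_nonneg (abs_nonneg x) (abs_nonneg y)]
  gcongr

/-! ### Hausdorff premeasures under inverse branches -/

/-- The `s`-dimensional Hausdorff premeasure at scale `r` on the real line. -/
noncomputable def hausdorffPremeasure (s : ℝ) (r : ℝ≥0∞) : MeasureTheory.OuterMeasure ℝ :=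
  MeasureTheory.OuterMeasure.mkMetric'.pre (fun A => Metric.ediam A ^ s) r

theorem hausdorffMeasure_eq_zero_of_premeasure {s : ℝ} {A : Set ℝ}
    (h : ∀ r : ℝ≥0∞, 0 < r → r ≠ ⊤ → hausdorffPremeasure s r A = 0) :
    MeasureTheory.Measure.hausdorffMeasure s A = 0 := by
  have h1 := MeasureTheory.OuterMeasure.mkMetric'.tendsto_pre
    (fun A : Set ℝ => Metric.ediam A ^ s) A
  have h2 : MeasureTheory.Measure.hausdorffMeasure s A =
      MeasureTheory.OuterMeasure.mkMetric' (fun A : Set ℝ => Metric.ediam A ^ s) A := by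
    rw [MeasureTheory.Measure.hausdorffMeasure, ← MeasureTheory.Measure.coe_toOuterMeasure,
      MeasureTheory.Measure.mkMetric_toOuterMeasure]
    rfl
  rw [h2]
  refine tendsto_nhds_unique h1 (tendsto_const_nhds.congr' ?_)
  filter_upwards [Ioo_mem_nhdsGT (zero_lt_one : (0 : ℝ≥0∞) < 1)] with r hr
  exact (h r hr.1 (hr.2.trans ENNReal.one_lt_top).ne).symm

/-- This finiteness is why premeasures are used: the halving argument below needs a finite starting
bound, and Hausdorff measure itself could be infinite. -/
theorem hausdorffPremeasure_lt_top {s : ℝ} (hs : 0 ≤ s) {r : ℝ≥0∞} (hr : 0 < r) (hr' : r ≠ ⊤)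
    {K : Set ℝ} (hK : IsCompact K) : hausdorffPremeasure s r K < ⊤ := by
  refine hK.induction_on (p := fun A => hausdorffPremeasure s r A < ⊤) (by simp)
    (fun A B hAB hB => (MeasureTheory.measure_mono hAB).trans_lt hB)
    (fun A B hA hB => (MeasureTheory.measure_union_le A B).trans_lt (ENNReal.add_lt_top.2 ⟨hA, hB⟩))
    fun x _ => ?_
  refine ⟨Metric.eball x (r / 2), mem_nhdsWithin_of_mem_nhds
    (Metric.eball_mem_nhds x (ENNReal.half_pos hr.ne')), ?_⟩
  have hd : Metric.ediam (Metric.eball x (r / 2)) ≤ r := by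
    refine Metric.ediam_eball_le.trans (le_of_eq ?_)
    rw [ENNReal.mul_div_cancel (by simp) (by simp)]
  refine (MeasureTheory.OuterMeasure.mkMetric'.pre_le hd).trans_lt ?_
  exact (ENNReal.rpow_le_rpow hd hs).trans_lt (ENNReal.rpow_lt_top_of_nonneg hs hr')

/-- The contraction weight of the digit `a + 1` in dimension `s`. -/
noncomputable def digitWeight (s : ℝ) (a : ℕ) : ℝ≥0∞ := ENNReal.ofReal (((a : ℝ) + 1) ^ (-(2 * s)))

theorem hausdorffPremeasure_image_inverseBranch_le {s : ℝ} (hs : 0 ≤ s) (r : ℝ≥0∞) (a : ℕ)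
    (A : Set ℝ) :
    hausdorffPremeasure s r (inverseBranch a '' A) ≤
      digitWeight s a * hausdorffPremeasure s r A := by
  have ha : (0 : ℝ) < (a : ℝ) + 1 := by positivity
  have hw0 : digitWeight s a ≠ 0 := by
    simp only [digitWeight, ne_eq, ENNReal.ofReal_eq_zero, not_le]; positivity
  have hwt : digitWeight s a ≠ ⊤ := ENNReal.ofReal_ne_top
  have hwt' : (digitWeight s a)⁻¹ ≠ ⊤ := ENNReal.inv_ne_top.2 hw0
  -- The premeasure is the largest outer measure bounded by `ediam ^ s` on sets of diameter at most
  -- `r`, so it suffices to test the rescaled pullback on such sets. Branches do not expand, so the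
  -- scale `r` is preserved.
  have key : (digitWeight s a)⁻¹ •
      MeasureTheory.OuterMeasure.comap (inverseBranch a) (hausdorffPremeasure s r) ≤
        hausdorffPremeasure s r := by
    refine MeasureTheory.OuterMeasure.mkMetric'.le_pre.2 fun B hB => ?_
    rw [smul_apply, MeasureTheory.OuterMeasure.comap_apply, smul_eq_mul,
      mul_comm, ← div_eq_mul_inv, ENNReal.div_le_iff hw0 hwt]
    have hd := (lipschitzWith_inverseBranch a).ediam_image_le B
    have hle1 : ((Real.toNNReal (((a : ℝ) + 1) ^ (-2 : ℝ)) : NNReal) : ℝ≥0∞) ≤ 1 := by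
      rw [ENNReal.coe_le_one_iff, Real.toNNReal_le_one]
      exact Real.rpow_le_one_of_one_le_of_nonpos (by linarith [(Nat.cast_nonneg a : (0 : ℝ) ≤ a)])
        (by norm_num)
    refine (MeasureTheory.OuterMeasure.mkMetric'.pre_le
      (hd.trans ((mul_le_of_le_one_left' hle1).trans hB))).trans ?_
    refine (ENNReal.rpow_le_rpow hd hs).trans (le_of_eq ?_)
    rw [ENNReal.mul_rpow_of_nonneg _ _ hs, mul_comm, digitWeight]
    congr 1
    change ENNReal.ofReal _ ^ s = _
    rw [ENNReal.ofReal_rpow_of_nonneg (by positivity) hs, ← Real.rpow_mul ha.le, neg_mul]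
  have h := key A
  rw [smul_apply, MeasureTheory.OuterMeasure.comap_apply, smul_eq_mul,
      mul_comm, ← div_eq_mul_inv, ENNReal.div_le_iff hw0 hwt] at h
  rwa [mul_comm]

theorem hausdorffPremeasure_le_tsum {s : ℝ} (hs : 0 ≤ s) (r : ℝ≥0∞) {A : Set ℝ} {B : ℕ → Set ℝ}
    (hA : A ⊆ unitIrrationals)
    (h : ∀ x ∈ A, ∀ a, partialQuotient x 1 = a + 1 → gaussMap x ∈ B a) :
    hausdorffPremeasure s r A ≤ ∑' a, digitWeight s a * hausdorffPremeasure s r (B a) := by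
  have hsub : A ⊆ ⋃ a, inverseBranch a '' B a := by
    intro x hx
    obtain ⟨a, ha, hxa⟩ := exists_eq_inverseBranch (hA hx)
    exact Set.mem_iUnion.2 ⟨a, gaussMap x, h x hx a ha, hxa.symm⟩
  refine (MeasureTheory.measure_mono hsub).trans ((MeasureTheory.measure_iUnion_le _).trans ?_)
  exact ENNReal.tsum_le_tsum fun a => hausdorffPremeasure_image_inverseBranch_le hs r a _

/-! ### Windows containing a large digit -/

/-- The total weight of all digits. -/
noncomputable def totalWeight (s : ℝ) : ℝ≥0∞ := ∑' a, digitWeight s a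

/-- The total weight of the digits that are at least `M`. -/
noncomputable def tailWeight (s M : ℝ) : ℝ≥0∞ :=
  ∑' a : ℕ, {b : ℕ | M ≤ (b : ℝ) + 1}.indicator (digitWeight s) a

theorem hausdorffPremeasure_iterate_preimage_le {s : ℝ} (hs : 0 ≤ s) (r : ℝ≥0∞) (L : ℕ)
    (B : Set ℝ) :
    hausdorffPremeasure s r {x | x ∈ unitIrrationals ∧ gaussMap^[L] x ∈ B} ≤
      totalWeight s ^ L * hausdorffPremeasure s r B := by
  induction L with
  | zero =>
    rw [pow_zero, one_mul]
    exact MeasureTheory.measure_mono fun x hx => hx.2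
  | succ L ih =>
    refine (hausdorffPremeasure_le_tsum hs r
      (B := fun _ => {x | x ∈ unitIrrationals ∧ gaussMap^[L] x ∈ B}) (fun x hx => hx.1)
      fun x hx a _ => ⟨gaussMap_mem_unitIrrationals hx.1, hx.2⟩).trans ?_
    rw [ENNReal.tsum_mul_right, pow_succ', mul_assoc]
    exact mul_le_mul_right ih _

/-- In `L` steps with one large digit, the premeasure of a set gains the factor
`L * tailWeight * totalWeight ^ L`. -/
theorem hausdorffPremeasure_exists_large_digit_le {s : ℝ} (hs : 0 ≤ s) (r : ℝ≥0∞) (L : ℕ) (M : ℝ)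
    (B : Set ℝ) (hZ : 1 ≤ totalWeight s) :
    hausdorffPremeasure s r {x | x ∈ unitIrrationals ∧ gaussMap^[L] x ∈ B ∧
        ∃ i < L, M ≤ (partialQuotient x (i + 1) : ℝ)} ≤
      L * tailWeight s M * totalWeight s ^ L * hausdorffPremeasure s r B := by
  induction L with
  | zero =>
    have : {x | x ∈ unitIrrationals ∧ gaussMap^[0] x ∈ B ∧
        ∃ i < 0, M ≤ (partialQuotient x (i + 1) : ℝ)} = ∅ := by ext; simp
    rw [this]
    simp
  | succ L ih =>
    set V := {x | x ∈ unitIrrationals ∧ gaussMap^[L] x ∈ B ∧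
        ∃ i < L, M ≤ (partialQuotient x (i + 1) : ℝ)} with hV
    set U := {x | x ∈ unitIrrationals ∧ gaussMap^[L] x ∈ B} with hU
    -- Either a later digit is large, which is the case `V` of the induction, or the first one is,
    -- and then only tail digits contribute.
    have hsplit : ∀ x ∈ {x | x ∈ unitIrrationals ∧ gaussMap^[L + 1] x ∈ B ∧
        ∃ i < L + 1, M ≤ (partialQuotient x (i + 1) : ℝ)}, ∀ a, partialQuotient x 1 = a + 1 →
          gaussMap x ∈ (fun a : ℕ => V ∪ {y | y ∈ U ∧ M ≤ (a : ℝ) + 1}) a := by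
      rintro x ⟨hx, hB, i, hi, hM⟩ a ha
      rcases i with _ | i
      · refine Or.inr ⟨⟨gaussMap_mem_unitIrrationals hx, hB⟩, ?_⟩
        rw [zero_add, ha] at hM
        exact_mod_cast hM
      · refine Or.inl ⟨gaussMap_mem_unitIrrationals hx, hB, i, by omega, ?_⟩
        have := partialQuotient_iterate x 1 i
        rw [Function.iterate_one] at this
        rwa [this, add_comm 1 i]
    refine (hausdorffPremeasure_le_tsum hs r (fun x hx => hx.1) hsplit).trans ?_
    have hterm : ∀ a, digitWeight s a *
        hausdorffPremeasure s r (V ∪ {y | y ∈ U ∧ M ≤ (a : ℝ) + 1}) ≤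
        digitWeight s a * hausdorffPremeasure s r V +
          {b : ℕ | M ≤ (b : ℝ) + 1}.indicator (digitWeight s) a * hausdorffPremeasure s r U := by
      intro a
      refine (mul_le_mul_right (MeasureTheory.measure_union_le _ _) _).trans ?_
      rw [mul_add]
      refine add_le_add le_rfl ?_
      by_cases h : M ≤ (a : ℝ) + 1
      · rw [Set.indicator_of_mem (by exact h)]
        exact mul_le_mul_right (MeasureTheory.measure_mono fun y hy => hy.1) _
      · simp [h]
    refine (ENNReal.tsum_le_tsum hterm).trans ?_
    rw [ENNReal.tsum_add, ENNReal.tsum_mul_right, ENNReal.tsum_mul_right]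
    have hUle := hausdorffPremeasure_iterate_preimage_le hs r L B
    calc totalWeight s * hausdorffPremeasure s r V + tailWeight s M * hausdorffPremeasure s r U
        ≤ totalWeight s * (L * tailWeight s M * totalWeight s ^ L * hausdorffPremeasure s r B) +
          tailWeight s M * (totalWeight s ^ (L + 1) * hausdorffPremeasure s r B) := by
          refine add_le_add (mul_le_mul_right ih _) (mul_le_mul_right (hUle.trans ?_) _)
          exact mul_le_mul_left (pow_le_pow_right₀ hZ (Nat.le_succ L)) _
      _ = _ := by push_cast; ring

/-- Jumping from time `n` to `n + L n` halves the premeasure of the points still subject to all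
later conditions. Repeating this from a finite bound forces it to vanish. -/
theorem hausdorffMeasure_eq_zero_of_large_digits {s : ℝ} (hs : 0 ≤ s) (hZ : 1 ≤ totalWeight s)
    (L : ℕ → ℕ) (M : ℕ → ℝ)
    (h : ∀ᶠ n in atTop, L n * tailWeight s (M n) * totalWeight s ^ L n ≤ 2⁻¹) {A : Set ℝ}
    (hA : A ⊆ unitIrrationals)
    (hAM : ∀ x ∈ A, ∀ᶠ n in atTop, ∃ i < L n, M n ≤ (partialQuotient x (n + i + 1) : ℝ)) :
    MeasureTheory.Measure.hausdorffMeasure s A = 0 := by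
  refine hausdorffMeasure_eq_zero_of_premeasure fun r hr hr' => ?_
  obtain ⟨N₀, hN₀⟩ := eventually_atTop.1 h
  -- `B n` contains the possible values of the `n`-th Gauss iterate when every window from time `n`
  -- on has a large digit.
  set B : ℕ → Set ℝ := fun n => {y | y ∈ unitIrrationals ∧
    ∀ m, ∃ i < L (n + m), M (n + m) ≤ (partialQuotient y (m + i + 1) : ℝ)} with hB
  have hstep : ∀ n, N₀ ≤ n →
      hausdorffPremeasure s r (B n) ≤ 2⁻¹ * hausdorffPremeasure s r (B (n + L n)) := by
    intro n hn
    refine (MeasureTheory.measure_mono fun y hy => ?_).trans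
      ((hausdorffPremeasure_exists_large_digit_le hs r (L n) (M n) (B (n + L n)) hZ).trans
        (mul_le_mul_left (hN₀ n hn) _))
    refine ⟨hy.1, ⟨iterate_gaussMap_mem_unitIrrationals hy.1 _, fun m => ?_⟩, ?_⟩
    · obtain ⟨i, hi, hM⟩ := hy.2 (L n + m)
      refine ⟨i, by rwa [add_assoc], ?_⟩
      rw [partialQuotient_iterate, add_assoc n]
      rwa [← add_assoc (L n) m i]
    · simpa using hy.2 0
  have hfin := hausdorffPremeasure_lt_top hs hr hr' (isCompact_Icc (a := (0 : ℝ)) (b := 1))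
  have hiter : ∀ k n, N₀ ≤ n → hausdorffPremeasure s r (B n) ≤
      2⁻¹ ^ k * hausdorffPremeasure s r (Set.Icc 0 1) := by
    intro k
    induction k with
    | zero =>
      intro n _
      rw [pow_zero, one_mul]
      exact MeasureTheory.measure_mono fun y hy => Set.Ioo_subset_Icc_self hy.1.1
    | succ k ih =>
      intro n hn
      refine (hstep n hn).trans ?_
      rw [pow_succ', mul_assoc]
      exact mul_le_mul_right (ih _ (by omega)) _
  have hzero : ∀ n, N₀ ≤ n → hausdorffPremeasure s r (B n) = 0 := by
    intro n hn
    have hlim : Tendsto (fun k : ℕ => (2⁻¹ : ℝ≥0∞) ^ k * hausdorffPremeasure s r (Set.Icc 0 1))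
        atTop (𝓝 (0 * hausdorffPremeasure s r (Set.Icc 0 1))) :=
      ENNReal.Tendsto.mul_const
        (ENNReal.tendsto_pow_atTop_nhds_zero_of_lt_one (by simp)) (Or.inr hfin.ne)
    rw [zero_mul] at hlim
    exact le_antisymm (ge_of_tendsto' hlim fun k => hiter k n hn) (zero_le)
  have hcover : A ⊆ ⋃ N : ℕ, {x | x ∈ unitIrrationals ∧ gaussMap^[N + N₀] x ∈ B (N + N₀)} := by
    intro x hx
    obtain ⟨N, hN⟩ := eventually_atTop.1 (hAM x hx)
    refine Set.mem_iUnion.2 ⟨N, hA hx, iterate_gaussMap_mem_unitIrrationals (hA hx) _, fun m => ?_⟩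
    obtain ⟨i, hi, hM⟩ := hN (N + N₀ + m) (by omega)
    refine ⟨i, hi, ?_⟩
    rwa [partialQuotient_iterate, ← add_assoc]
  refine MeasureTheory.measure_mono_null hcover (MeasureTheory.measure_iUnion_null fun N => ?_)
  refine le_antisymm ((hausdorffPremeasure_iterate_preimage_le hs r _ _).trans ?_) (zero_le)
  rw [hzero _ (by omega), mul_zero]

/-! ### Estimates and the upper bound -/

theorem summable_digitWeight {s : ℝ} (hs : 1 / 2 < s) :
    Summable fun a : ℕ => ((a : ℝ) + 1) ^ (-(2 * s)) := by
  have := (summable_nat_add_iff 1).2 (Real.summable_nat_rpow.2 (show -(2 * s) < -1 by linarith))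
  simpa using this

theorem totalWeight_ne_top {s : ℝ} (hs : 1 / 2 < s) : totalWeight s ≠ ⊤ :=
  (summable_digitWeight hs).tsum_ofReal_ne_top

theorem one_le_totalWeight (s : ℝ) : 1 ≤ totalWeight s := by
  have h := ENNReal.le_tsum (f := digitWeight s) 0
  refine le_trans ?_ h
  simp [digitWeight]

theorem totalWeight_antitone : Antitone totalWeight := by
  intro s t hst
  refine ENNReal.tsum_le_tsum fun a => ENNReal.ofReal_le_ofReal ?_
  exact Real.rpow_le_rpow_of_exponent_le (by linarith [(Nat.cast_nonneg a : (0 : ℝ) ≤ a)])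
    (by linarith)

/-- Half of the excess exponent `2η` pays for the decay in `M`; the other half keeps the remaining
series convergent when `η > 0`. -/
theorem tailWeight_le {η M : ℝ} (hη : 0 ≤ η) (hM : 0 < M) :
    tailWeight (1 / 2 + η) M ≤ ENNReal.ofReal (M ^ (-η)) * totalWeight (1 / 2 + η / 2) := by
  rw [totalWeight, ← ENNReal.tsum_mul_left]
  refine ENNReal.tsum_le_tsum fun a => ?_
  by_cases h : M ≤ (a : ℝ) + 1
  · rw [Set.indicator_of_mem (by exact h), digitWeight, digitWeight,
      ← ENNReal.ofReal_mul (by positivity)]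
    refine ENNReal.ofReal_le_ofReal ?_
    rw [show -(2 * (1 / 2 + η)) = -η + -(2 * (1 / 2 + η / 2)) by ring,
      Real.rpow_add (by positivity)]
    exact mul_le_mul_of_nonneg_right (Real.rpow_le_rpow_of_nonpos hM h (by linarith))
      (by positivity)
  · simp [h]

theorem tendsto_sq_mul_exp_neg_mul_sqrt (C : ℝ) {b : ℝ} (hb : 0 < b) :
    Tendsto (fun n : ℕ => C * ((√(n : ℝ) + 1) ^ 2 * Real.exp (-b * √(n : ℝ)))) atTop (𝓝 0) := by
  have h1 : Tendsto (fun n : ℕ => b * (√(n : ℝ) + 1)) atTop atTop :=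
    (tendsto_atTop_add_const_right _ _
      (Real.tendsto_sqrt_atTop.comp tendsto_natCast_atTop_atTop)).const_mul_atTop hb
  have h2 := ((Real.tendsto_pow_mul_exp_neg_atTop_nhds_zero 2).comp h1).const_mul
    (C * b⁻¹ ^ 2 * Real.exp b)
  rw [mul_zero] at h2
  refine h2.congr fun n => ?_
  simp only [Function.comp]
  rw [show -(b * (√(n : ℝ) + 1)) = -b + -b * √(n : ℝ) by ring, Real.exp_add, Real.exp_neg]
  field_simp

/-- The threshold `γ = 1/2` matters here: the relative gain `y / n ≥ 1 / (D √n)` is multiplied by `n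
^ γ ≥ √n`. The bound `y ≤ 3 n` is what `1 + t / 3 ≤ √(1 + t)` requires. -/
theorem rpow_add_const_le {n y γ D : ℝ} (hn : 1 ≤ n) (hγ : 1 / 2 ≤ γ) (hD : 0 < D)
    (hy : √n / D ≤ y) (hy' : y ≤ 3 * n) : n ^ γ + 1 / (3 * D) ≤ (n + y) ^ γ := by
  have hn0 : 0 < n := by linarith
  have hy0 : 0 ≤ y := le_trans (by positivity) hy
  have h1 : 1 + y / n / 3 ≤ (1 + y / n) ^ γ := by
    have hyn : y / n ≤ 3 := by rw [div_le_iff₀ hn0]; linarith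
    have hyn0 : 0 ≤ y / n := by positivity
    calc 1 + y / n / 3 ≤ √(1 + y / n) := by
          refine Real.le_sqrt_of_sq_le ?_
          nlinarith
      _ = (1 + y / n) ^ (1 / 2 : ℝ) := Real.sqrt_eq_rpow _
      _ ≤ (1 + y / n) ^ γ := Real.rpow_le_rpow_of_exponent_le (by linarith) hγ
  have h2 : √n ≤ n ^ γ := by
    rw [Real.sqrt_eq_rpow]
    exact Real.rpow_le_rpow_of_exponent_le hn hγ
  have h3 : 1 / (3 * D) ≤ n ^ γ * (y / n / 3) := by
    calc 1 / (3 * D) = √n * ((√n / D) / n / 3) := by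
          have := Real.mul_self_sqrt hn0.le
          field_simp
          nlinarith
      _ ≤ n ^ γ * (y / n / 3) := by gcongr
  calc n ^ γ + 1 / (3 * D) ≤ n ^ γ * (1 + y / n / 3) := by linarith
    _ ≤ n ^ γ * (1 + y / n) ^ γ := by gcongr
    _ = (n + y) ^ γ := by
      rw [← Real.mul_rpow hn0.le (by positivity)]
      congr 1
      field_simp

theorem sumPartialQuotients_add (x : ℝ) (n L : ℕ) :
    sumPartialQuotients x (n + L) =
      sumPartialQuotients x n + ∑ i ∈ Finset.range L, partialQuotient x (n + i + 1) := by
  induction L with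
  | zero => simp
  | succ L ih =>
    rw [Finset.sum_range_succ, ← add_assoc (sumPartialQuotients x n), ← ih]
    unfold sumPartialQuotients
    rw [← add_assoc n, Finset.sum_Icc_succ_top (by omega)]

theorem exists_large_digit_of_mem_growthSet {γ D : ℝ} (hγ : 1 / 2 ≤ γ) (hD : 1 ≤ D) {x : ℝ}
    (hx : x ∈ growthSet fun n : ℕ => Real.exp ((n : ℝ) ^ γ)) :
    ∀ᶠ n : ℕ in atTop, ∃ i < ⌈√(n : ℝ) / D⌉₊,
      1 / (12 * D) * Real.exp (√(n : ℝ)) / ⌈√(n : ℝ) / D⌉₊ ≤ (partialQuotient x (n + i + 1) : ℝ) := by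
  -- With this choice `4 * ε` is the exponent gain `1 / (3 * D)`, and `(1 - ε) * (1 + 4 * ε) - (1 +
  -- ε) = 2 * ε - 4 * ε ^ 2 ≥ ε`, so the window sum is at least `ε * exp (n ^ γ)`.
  set ε := 1 / (12 * D) with hε
  have hD0 : 0 < D := by linarith
  have hε0 : 0 < ε := by positivity
  have hε1 : ε ≤ 1 / 12 := by
    rw [hε]
    exact one_div_le_one_div_of_le (by norm_num) (by linarith)
  obtain ⟨N, hN⟩ := eventually_atTop.1
    ((Metric.tendsto_nhds.1 hx.2.2 ε hε0))
  filter_upwards [eventually_ge_atTop N, eventually_ge_atTop 1] with n hn hn1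
  have hn1' : (1 : ℝ) ≤ n := by exact_mod_cast hn1
  have hsq1 : 1 ≤ √(n : ℝ) := Real.one_le_sqrt.2 hn1'
  have hsqn : √(n : ℝ) ≤ n := by
    rw [Real.sqrt_le_left (by linarith)]
    nlinarith
  set L := ⌈√(n : ℝ) / D⌉₊ with hL
  have hLge : √(n : ℝ) / D ≤ L := Nat.le_ceil _
  have hLlt : (L : ℝ) < √(n : ℝ) / D + 1 := Nat.ceil_lt_add_one (by positivity)
  have hLpos : (0 : ℝ) < L := lt_of_lt_of_le (by positivity) hLge
  have hdiv : √(n : ℝ) / D ≤ √(n : ℝ) := div_le_self (by positivity) hD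
  have hgrow := rpow_add_const_le hn1' hγ hD0 hLge (by linarith)
  have hlow := abs_lt.1 (hN (n + L) (by omega))
  have hup := abs_lt.1 (hN n hn)
  have hlow' : (1 - ε) * Real.exp (((n + L : ℕ) : ℝ) ^ γ) ≤ sumPartialQuotients x (n + L) := by
    rw [← le_div_iff₀ (Real.exp_pos _)]
    linarith [hlow.1]
  have hup' : (sumPartialQuotients x n : ℝ) ≤ (1 + ε) * Real.exp ((n : ℝ) ^ γ) := by
    rw [← div_le_iff₀ (Real.exp_pos _)]
    linarith [hup.2]
  have hexp : Real.exp ((n : ℝ) ^ γ) * (1 + 4 * ε) ≤ Real.exp (((n + L : ℕ) : ℝ) ^ γ) := by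
    have h4 : 4 * ε = 1 / (3 * D) := by rw [hε]; field_simp; norm_num
    rw [h4]
    push_cast
    calc Real.exp ((n : ℝ) ^ γ) * (1 + 1 / (3 * D))
        ≤ Real.exp ((n : ℝ) ^ γ) * Real.exp (1 / (3 * D)) := by
          gcongr
          linarith [Real.add_one_le_exp (1 / (3 * D))]
      _ = Real.exp ((n : ℝ) ^ γ + 1 / (3 * D)) := (Real.exp_add _ _).symm
      _ ≤ _ := Real.exp_le_exp.2 hgrow
  have hφ : Real.exp (√(n : ℝ)) ≤ Real.exp ((n : ℝ) ^ γ) := by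
    rw [Real.exp_le_exp, Real.sqrt_eq_rpow]
    exact Real.rpow_le_rpow_of_exponent_le hn1' hγ
  by_contra! hcon
  have hsum : (∑ i ∈ Finset.range L, (partialQuotient x (n + i + 1) : ℝ)) <
      ε * Real.exp (√(n : ℝ)) := by
    have hne : (Finset.range L).Nonempty :=
      Finset.nonempty_range_iff.2 (by rintro h; rw [h] at hLpos; simp at hLpos)
    refine (Finset.sum_lt_sum_of_nonempty hne fun i hi => hcon i (Finset.mem_range.1 hi)).trans_eq ?_
    rw [Finset.sum_const, Finset.card_range, nsmul_eq_mul]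
    field_simp
  have hadd : (sumPartialQuotients x (n + L) : ℝ) = sumPartialQuotients x n +
      ∑ i ∈ Finset.range L, (partialQuotient x (n + i + 1) : ℝ) := by
    exact_mod_cast sumPartialQuotients_add x n L
  have hpos := Real.exp_pos ((n : ℝ) ^ γ)
  have h5 : (1 - ε) * (Real.exp ((n : ℝ) ^ γ) * (1 + 4 * ε)) ≤ sumPartialQuotients x (n + L) :=
    (mul_le_mul_of_nonneg_left hexp (by linarith)).trans hlow'
  have h6 : ε * Real.exp (√(n : ℝ)) ≤ ε * Real.exp ((n : ℝ) ^ γ) := by gcongr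
  nlinarith [mul_pos hε0 hpos, mul_nonneg (mul_pos hε0 hpos).le (sub_nonneg.2 hε1)]

theorem hausdorffMeasure_growthSet_eq_zero {γ η : ℝ} (hγ : 1 / 2 ≤ γ) (hη : 0 < η) (hη1 : η ≤ 1) :
    MeasureTheory.Measure.hausdorffMeasure (1 / 2 + η)
      (growthSet fun n : ℕ => Real.exp ((n : ℝ) ^ γ)) = 0 := by
  set z := (totalWeight (1 / 2 + η / 2)).toReal with hz
  have hzt : totalWeight (1 / 2 + η / 2) = ENNReal.ofReal z :=
    (ENNReal.ofReal_toReal (totalWeight_ne_top (by linarith))).symm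
  have hz1 : 1 ≤ z := by
    have := one_le_totalWeight (1 / 2 + η / 2)
    rwa [hzt, ENNReal.one_le_ofReal] at this
  have hz0 : 0 < z := by linarith
  have hlogz : 0 ≤ Real.log z := Real.log_nonneg hz1
  -- Large enough that `z ^ L`, with `L` about `√n / D`, consumes at most half of the decay `exp (-η
  -- √n)`.
  set D := 1 + 2 * Real.log z / η with hD
  have hD1 : 1 ≤ D := by
    have : 0 ≤ 2 * Real.log z / η := by positivity
    linarith
  have hD0 : 0 < D := by linarith
  have hDlog : Real.log z / D ≤ η / 2 := by
    rw [div_le_iff₀ hD0, hD]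
    field_simp
    nlinarith
  set ε := 1 / (12 * D) with hε
  have hε0 : 0 < ε := by positivity
  refine hausdorffMeasure_eq_zero_of_large_digits (by positivity) (one_le_totalWeight _)
    (fun n => ⌈√(n : ℝ) / D⌉₊)
    (fun n => ε * Real.exp (√(n : ℝ)) / ⌈√(n : ℝ) / D⌉₊) ?_
    (fun x hx => ⟨hx.1, hx.2.1⟩) (fun x hx => exists_large_digit_of_mem_growthSet hγ hD1 hx)
  filter_upwards [(tendsto_sq_mul_exp_neg_mul_sqrt (z ^ 2 * ε ^ (-η)) (half_pos hη)).eventually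
    (eventually_le_nhds (show (0 : ℝ) < 2⁻¹ by norm_num)), eventually_ge_atTop 1] with n hlim hn1
  have hn1' : (1 : ℝ) ≤ n := by exact_mod_cast hn1
  have hsq1 : 1 ≤ √(n : ℝ) := Real.one_le_sqrt.2 hn1'
  set L := ⌈√(n : ℝ) / D⌉₊ with hL
  have hLge : √(n : ℝ) / D ≤ L := Nat.le_ceil _
  have hLlt : (L : ℝ) < √(n : ℝ) / D + 1 := Nat.ceil_lt_add_one (by positivity)
  have hLpos : (0 : ℝ) < L := lt_of_lt_of_le (by positivity) hLge
  have hL1 : (1 : ℝ) ≤ L := by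
    have : 0 < L := by exact_mod_cast hLpos
    exact_mod_cast this
  have hdiv : √(n : ℝ) / D ≤ √(n : ℝ) := div_le_self (by positivity) hD1
  have hLle : (L : ℝ) ≤ √(n : ℝ) + 1 := by linarith
  set M := ε * Real.exp (√(n : ℝ)) / L with hM
  have hM0 : 0 < M := by positivity
  have hMpow : M ^ (-η) ≤ ε ^ (-η) * Real.exp (-η * √(n : ℝ)) * (√(n : ℝ) + 1) := by
    rw [hM, Real.div_rpow (by positivity) hLpos.le, Real.mul_rpow hε0.le (Real.exp_pos _).le,
      ← Real.exp_mul, mul_comm (√(n : ℝ)) (-η), Real.rpow_neg hLpos.le, div_inv_eq_mul]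
    gcongr
    calc (L : ℝ) ^ η ≤ (L : ℝ) ^ (1 : ℝ) := Real.rpow_le_rpow_of_exponent_le hL1 hη1
      _ = L := Real.rpow_one _
      _ ≤ _ := hLle
  have hzpow : z ^ L ≤ z * Real.exp (η / 2 * √(n : ℝ)) := by
    rw [← Real.rpow_natCast, Real.rpow_def_of_pos hz0]
    calc Real.exp (Real.log z * L) ≤ Real.exp (Real.log z + η / 2 * √(n : ℝ)) := by
          refine Real.exp_le_exp.2 ?_
          calc Real.log z * L ≤ Real.log z * (√(n : ℝ) / D + 1) := by gcongr
            _ = Real.log z + Real.log z / D * √(n : ℝ) := by ring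
            _ ≤ _ := by gcongr
      _ = _ := by rw [Real.exp_add, Real.exp_log hz0]
  have hreal : L * (M ^ (-η) * z) * z ^ L ≤ 2⁻¹ := by
    refine le_trans ?_ hlim
    calc L * (M ^ (-η) * z) * z ^ L
        ≤ (√(n : ℝ) + 1) * (ε ^ (-η) * Real.exp (-η * √(n : ℝ)) * (√(n : ℝ) + 1) * z) *
          (z * Real.exp (η / 2 * √(n : ℝ))) := by gcongr
      _ = z ^ 2 * ε ^ (-η) * ((√(n : ℝ) + 1) ^ 2 *
          (Real.exp (-η * √(n : ℝ)) * Real.exp (η / 2 * √(n : ℝ)))) := by ring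
      _ = _ := by rw [← Real.exp_add]; congr 4; ring
  calc (L : ℝ≥0∞) * tailWeight (1 / 2 + η) M * totalWeight (1 / 2 + η) ^ L
      ≤ L * (ENNReal.ofReal (M ^ (-η)) * ENNReal.ofReal z) * ENNReal.ofReal z ^ L := by
        gcongr
        · rw [← hzt]; exact tailWeight_le hη.le hM0
        · rw [← hzt]; exact totalWeight_antitone (by linarith)
    _ = ENNReal.ofReal (L * (M ^ (-η) * z) * z ^ L) := by
        rw [← ENNReal.ofReal_mul (by positivity), ← ENNReal.ofReal_pow hz0.le,
          ← ENNReal.ofReal_natCast, ← ENNReal.ofReal_mul (by positivity),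
          ← ENNReal.ofReal_mul (by positivity)]
    _ ≤ ENNReal.ofReal 2⁻¹ := ENNReal.ofReal_le_ofReal hreal
    _ = 2⁻¹ := by rw [ENNReal.ofReal_inv_of_pos (by norm_num)]; simp

theorem dimH_growthSet_le {γ : ℝ} (hγ : 1 / 2 ≤ γ) :
    dimH (growthSet fun n : ℕ => Real.exp ((n : ℝ) ^ γ)) ≤ 1 / 2 := by
  refine ENNReal.le_of_forall_pos_le_add fun η hη _ => ?_
  set η' : NNReal := min η 1 with hη'
  have h0 : (0 : ℝ) < η' := by exact_mod_cast lt_min hη zero_lt_one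
  have h1 : (η' : ℝ) ≤ 1 := by exact_mod_cast min_le_right η 1
  have hzero := hausdorffMeasure_growthSet_eq_zero hγ h0 h1
  have h2 := dimH_le_of_hausdorffMeasure_ne_top (d := 1 / 2 + η')
    (s := growthSet fun n : ℕ => Real.exp ((n : ℝ) ^ γ)) (by
      push_cast
      rw [hzero]
      simp)
  refine h2.trans ?_
  push_cast
  refine add_le_add (by simp) ?_
  exact_mod_cast min_le_left η 1

/-! ### Irrationals with prescribed partial quotients -/

theorem gaussMap_ratCast (q : ℚ) : gaussMap (q : ℝ) = ((Int.fract q⁻¹ : ℚ) : ℝ) := by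
  simp [gaussMap]

/-- This is Euclid's algorithm: each step on a positive rational lowers the numerator. -/
theorem exists_iterate_gaussMap_ratCast_eq_zero (m : ℕ) (q : ℚ) (hq : 0 ≤ q)
    (hm : q.num.toNat ≤ m) : ∃ k, gaussMap^[k] (q : ℝ) = 0 := by
  induction m generalizing q with
  | zero =>
    have h1 : q.num = 0 := by have := Rat.num_nonneg.2 hq; omega
    exact ⟨0, by simp [Rat.num_eq_zero.1 h1]⟩
  | succ m ih =>
    rcases hq.eq_or_lt with rfl | hq0
    · exact ⟨0, by simp⟩
    · have h1 := Rat.fract_inv_num_lt_num_of_pos hq0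
      have h2 := Rat.num_pos.2 hq0
      obtain ⟨k, hk⟩ := ih (Int.fract q⁻¹) (Int.fract_nonneg _) (by omega)
      refine ⟨k + 1, ?_⟩
      rw [Function.iterate_succ_apply, gaussMap_ratCast, hk]

theorem irrational_of_iterate_gaussMap_ne_zero {x : ℝ} (hx : 0 ≤ x)
    (h : ∀ k, gaussMap^[k] x ≠ 0) : Irrational x := by
  rintro ⟨q, rfl⟩
  obtain ⟨k, hk⟩ := exists_iterate_gaussMap_ratCast_eq_zero _ q (by exact_mod_cast hx) le_rfl
  exact h k hk

/-- The points whose continued fraction expansion starts with `c i, …, c (i + n - 1)`. -/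
def cylinder (c : ℕ → ℕ) : ℕ → ℕ → Set ℝ
  | 0, _ => Set.Icc 0 1
  | n + 1, i => (fun y : ℝ => ((c i : ℝ) + y)⁻¹) '' cylinder c n (i + 1)

theorem cylinder_succ_subset {c : ℕ → ℕ} (hc : ∀ i, 2 ≤ c i) (n i : ℕ) :
    cylinder c (n + 1) i ⊆ cylinder c n i := by
  induction n generalizing i with
  | zero =>
    rintro _ ⟨y, hy, rfl⟩
    have h2 : (2 : ℝ) ≤ c i := by exact_mod_cast hc i
    have h3 : 0 ≤ y := hy.1
    exact ⟨inv_nonneg.2 (by linarith), inv_le_one_of_one_le₀ (by linarith)⟩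
  | succ n ih => exact Set.image_mono (ih (i + 1))

theorem cylinder_subset_Icc {c : ℕ → ℕ} (hc : ∀ i, 2 ≤ c i) (n i : ℕ) :
    cylinder c n i ⊆ Set.Icc 0 1 := by
  induction n with
  | zero => exact subset_rfl
  | succ n ih => exact (cylinder_succ_subset hc n i).trans ih

theorem isCompact_cylinder {c : ℕ → ℕ} (hc : ∀ i, 2 ≤ c i) (n i : ℕ) :
    IsCompact (cylinder c n i) := by
  induction n generalizing i with
  | zero => exact isCompact_Icc
  | succ n ih =>
    refine (ih (i + 1)).image_of_continuousOn (ContinuousOn.inv₀ (by fun_prop) fun y hy => ?_)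
    have h2 : (2 : ℝ) ≤ c i := by exact_mod_cast hc i
    have h3 : 0 ≤ y := (cylinder_subset_Icc hc _ _ hy).1
    linarith

theorem cylinder_nonempty (c : ℕ → ℕ) (n i : ℕ) : (cylinder c n i).Nonempty := by
  induction n generalizing i with
  | zero => exact ⟨0, by simp [cylinder]⟩
  | succ n ih => exact (ih (i + 1)).image _

/-- A point common to the nested compact cylinders works. Digits at least `2` keep all its iterates
strictly between `0` and `1`, so the floors are unambiguous and no iterate vanishes. -/
theorem exists_unitIrrationals_partialQuotient_eq {c : ℕ → ℕ} (hc : ∀ i, 2 ≤ c i) :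
    ∃ x ∈ unitIrrationals, ∀ i, partialQuotient x (i + 1) = c i := by
  have hpos : ∀ i x, (∀ n, x ∈ cylinder c n i) → 0 < x ∧ x < 1 := by
    intro i x hx
    obtain ⟨y, hy, rfl⟩ := hx 1
    have h2 : (2 : ℝ) ≤ c i := by exact_mod_cast hc i
    have h3 : 0 ≤ y := hy.1
    exact ⟨inv_pos.2 (by linarith), inv_lt_one_of_one_lt₀ (by linarith)⟩
  have hstep : ∀ i x, (∀ n, x ∈ cylinder c n i) →
      (∀ n, gaussMap x ∈ cylinder c n (i + 1)) ∧ ⌊x⁻¹⌋₊ = c i := by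
    intro i x hx
    have hmem : ∀ n, x⁻¹ - c i ∈ cylinder c n (i + 1) := by
      intro n
      obtain ⟨y, hy, rfl⟩ := hx (n + 1)
      simpa using hy
    have h01 := hpos _ _ hmem
    have hfl : ⌊x⁻¹⌋ = c i := by
      rw [Int.floor_eq_iff]
      push_cast
      exact ⟨by linarith, by linarith⟩
    refine ⟨?_, ?_⟩
    · intro n
      rw [gaussMap, Int.fract, hfl]
      exact_mod_cast hmem n
    · rw [← Int.floor_toNat, hfl]
      simp
  obtain ⟨x, hx⟩ := IsCompact.nonempty_iInter_of_sequence_nonempty_isCompact_isClosed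
    (fun n => cylinder c n 0) (fun n => cylinder_succ_subset hc n 0)
    (fun n => cylinder_nonempty c n 0) (isCompact_cylinder hc 0 0)
    (fun n => (isCompact_cylinder hc n 0).isClosed)
  have hiter : ∀ i n, gaussMap^[i] x ∈ cylinder c n i := by
    intro i
    induction i with
    | zero => exact fun n => Set.mem_iInter.1 hx n
    | succ i ih =>
      rw [Function.iterate_succ_apply']
      exact (hstep i _ ih).1
  refine ⟨x, ⟨hpos 0 x (hiter 0), ?_⟩, fun i => (hstep i _ (hiter i)).2⟩
  exact irrational_of_iterate_gaussMap_ne_zero (hpos 0 x (hiter 0)).1.le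
    fun k => (hpos k _ (hiter k)).1.ne'

/-! ### Separation of points with different digits -/

theorem eq_inv_partialQuotient_add {x : ℝ} (hx : x ∈ unitIrrationals) :
    x = ((partialQuotient x 1 : ℝ) + gaussMap x)⁻¹ := by
  obtain ⟨a, ha, hxa⟩ := exists_eq_inverseBranch hx
  rw [inverseBranch, abs_of_pos (gaussMap_mem_unitIrrationals hx).1.1] at hxa
  rw [ha]
  exact_mod_cast hxa

theorem le_half_of_two_le_partialQuotient {x : ℝ} (hx : x ∈ unitIrrationals)
    (h : 2 ≤ partialQuotient x 1) : x ≤ 1 / 2 := by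
  have h1 : (2 : ℝ) ≤ partialQuotient x 1 := by exact_mod_cast h
  rw [eq_inv_partialQuotient_add hx, one_div]
  exact inv_anti₀ (by norm_num) (by linarith [(gaussMap_mem_unitIrrationals hx).1.1])

/-- Each common digit shrinks distances by a factor no smaller than `(A i ^ 2)⁻¹`. At the first
disagreement the reciprocals differ by at least `1/2`, since the next digit of the point with the
smaller digit is at least `2`. -/
theorem prod_le_abs_sub_of_partialQuotient_ne {x y : ℝ} (hx : x ∈ unitIrrationals)
    (hy : y ∈ unitIrrationals) (hx2 : ∀ i, 2 ≤ partialQuotient x (i + 1))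
    (hy2 : ∀ i, 2 ≤ partialQuotient y (i + 1)) {A : ℕ → ℝ}
    (hxA : ∀ i, (partialQuotient x (i + 1) : ℝ) + 1 ≤ A i)
    (hyA : ∀ i, (partialQuotient y (i + 1) : ℝ) + 1 ≤ A i) {n : ℕ}
    (heq : ∀ i < n, partialQuotient x (i + 1) = partialQuotient y (i + 1))
    (hne : partialQuotient x (n + 1) ≠ partialQuotient y (n + 1)) :
    1 / 2 * ∏ i ∈ Finset.range (n + 1), (A i ^ 2)⁻¹ ≤ |x - y| := by
  induction n generalizing x y A with
  | zero =>
    wlog hlt : partialQuotient x 1 < partialQuotient y 1 generalizing x y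
    · rw [abs_sub_comm]
      exact this hy hx hy2 hx2 hyA hxA (by simp) hne.symm
        (lt_of_le_of_ne (not_lt.1 hlt) (Ne.symm hne))
    have hx' := gaussMap_mem_unitIrrationals hx
    have hy' := gaussMap_mem_unitIrrationals hy
    have hxh : gaussMap x ≤ 1 / 2 :=
      le_half_of_two_le_partialQuotient hx' (by simpa using (partialQuotient_iterate x 1 0) ▸ hx2 1)
    have hlt' : (partialQuotient x 1 : ℝ) + 1 ≤ partialQuotient y 1 := by exact_mod_cast hlt
    have hc : (0 : ℝ) ≤ partialQuotient x 1 := by positivity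
    have hxA0 := hxA 0
    have hyA0 := hyA 0
    rw [zero_add] at hxA0 hyA0
    have hu := hx'.1
    have hv := hy'.1
    refine le_trans ?_ (le_abs_self _)
    rw [eq_inv_partialQuotient_add hx, eq_inv_partialQuotient_add hy,
      inv_sub_inv (by linarith [hu.1]) (by linarith [hv.1])]
    simp only [zero_add, Finset.range_one, Finset.prod_singleton]
    rw [← div_eq_mul_inv]
    have hd1 : 0 < (partialQuotient x 1 : ℝ) + gaussMap x := by linarith [hu.1]
    have hd2 : 0 < (partialQuotient y 1 : ℝ) + gaussMap y := by linarith [hv.1]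
    refine div_le_div₀ ?_ ?_ (mul_pos hd1 hd2) ?_
    · linarith [hv.1]
    · linarith [hv.1]
    · rw [sq]
      exact mul_le_mul (by linarith [hu.2]) (by linarith [hv.2]) hd2.le (by linarith)
  | succ n ih =>
    have hx' := gaussMap_mem_unitIrrationals hx
    have hy' := gaussMap_mem_unitIrrationals hy
    have hpx : ∀ i, partialQuotient (gaussMap x) (i + 1) = partialQuotient x (i + 1 + 1) := by
      intro i
      exact (partialQuotient_iterate x 1 i).trans (by rw [add_comm 1 i])
    have hpy : ∀ i, partialQuotient (gaussMap y) (i + 1) = partialQuotient y (i + 1 + 1) := by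
      intro i
      exact (partialQuotient_iterate y 1 i).trans (by rw [add_comm 1 i])
    have hih := ih hx' hy' (A := fun i => A (i + 1))
      (fun i => by rw [hpx]; exact hx2 _) (fun i => by rw [hpy]; exact hy2 _)
      (fun i => by rw [hpx]; exact hxA _) (fun i => by rw [hpy]; exact hyA _)
      (fun i hi => by rw [hpx, hpy]; exact heq _ (by omega)) (by rw [hpx, hpy]; exact hne)
    have h0 : partialQuotient x 1 = partialQuotient y 1 := heq 0 (by omega)
    have hxA0 := hxA 0
    rw [zero_add] at hxA0
    have hu := hx'.1
    have hv := hy'.1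
    have hc : (0 : ℝ) ≤ partialQuotient x 1 := by positivity
    have hd1 : 0 < (partialQuotient x 1 : ℝ) + gaussMap x := by linarith [hu.1]
    have hd2 : 0 < (partialQuotient x 1 : ℝ) + gaussMap y := by linarith [hv.1]
    have habs : |x - y| = |gaussMap x - gaussMap y| /
        (((partialQuotient x 1 : ℝ) + gaussMap x) * ((partialQuotient x 1 : ℝ) + gaussMap y)) := by
      conv_lhs => rw [eq_inv_partialQuotient_add hx, eq_inv_partialQuotient_add hy, ← h0,
        inv_sub_inv hd1.ne' hd2.ne', add_sub_add_left_eq_sub, abs_div, abs_of_pos (mul_pos hd1 hd2),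
        abs_sub_comm]
    rw [habs, Finset.prod_range_succ', ← mul_assoc, ← div_eq_mul_inv]
    refine div_le_div₀ (abs_nonneg _) hih (mul_pos hd1 hd2) ?_
    rw [sq]
    exact mul_le_mul (by linarith [hu.2]) (by linarith [hv.2]) hd2.le (by linarith)

/-! ### Hölder inverses and mixed-radix expansions -/

theorem mul_dimH_le_dimH_image {g : ℝ → ℝ} {S : Set ℝ} {C r : NNReal} (hr : 0 < r)
    (h : ∀ t ∈ S, ∀ u ∈ S, |t - u| ≤ C * |g t - g u| ^ (r : ℝ)) :
    r * dimH S ≤ dimH (g '' S) := by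
  have hinj : Set.InjOn g S := by
    intro t ht u hu htu
    have := h t ht u hu
    rw [htu, sub_self, abs_zero, Real.zero_rpow (by exact_mod_cast hr.ne'), mul_zero] at this
    exact sub_eq_zero.1 (abs_eq_zero.1 (le_antisymm this (abs_nonneg _)))
  have hinv : Set.LeftInvOn (Function.invFunOn g S) g S := hinj.leftInvOn_invFunOn
  have hH : HolderOnWith C r (Function.invFunOn g S) (g '' S) := by
    rintro _ ⟨t, ht, rfl⟩ _ ⟨u, hu, rfl⟩
    rw [hinv ht, hinv hu, edist_dist, edist_dist, Real.dist_eq, Real.dist_eq,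
      ENNReal.ofReal_rpow_of_nonneg (abs_nonneg _) r.coe_nonneg, ← ENNReal.ofReal_coe_nnreal,
      ← ENNReal.ofReal_mul C.coe_nonneg]
    exact ENNReal.ofReal_le_ofReal (h t ht u hu)
  have := hH.dimH_image_le hr
  rw [hinv.image_image] at this
  rw [mul_comm]
  exact ENNReal.mul_le_of_le_div this

/-- The remainder after `n` steps of the expansion of `t` in the mixed radix `N`. -/
noncomputable def radixRemainder (N : ℕ → ℕ) (t : ℝ) : ℕ → ℝ
  | 0 => t
  | n + 1 => Int.fract (N n * radixRemainder N t n)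

/-- The digits of the expansion of `t` in the mixed radix `N`. -/
noncomputable def radixDigit (N : ℕ → ℕ) (t : ℝ) (n : ℕ) : ℕ := ⌊N n * radixRemainder N t n⌋₊

theorem radixRemainder_mem_Ico (N : ℕ → ℕ) {t : ℝ} (ht : t ∈ Set.Ico (0 : ℝ) 1) (n : ℕ) :
    radixRemainder N t n ∈ Set.Ico (0 : ℝ) 1 := by
  cases n with
  | zero => exact ht
  | succ n => exact ⟨Int.fract_nonneg _, Int.fract_lt_one _⟩

theorem radixDigit_lt {N : ℕ → ℕ} (hN : ∀ i, 2 ≤ N i) {t : ℝ} (ht : t ∈ Set.Ico (0 : ℝ) 1)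
    (n : ℕ) : radixDigit N t n < N n := by
  have h := radixRemainder_mem_Ico N ht n
  have hpos : (0 : ℝ) < N n := by exact_mod_cast (by have := hN n; omega : 0 < N n)
  rw [radixDigit, Nat.floor_lt (mul_nonneg hpos.le h.1)]
  exact mul_lt_of_lt_one_right hpos h.2

theorem abs_sub_le_of_radixDigit_eq {N : ℕ → ℕ} (hN : ∀ i, 2 ≤ N i) {t u : ℝ}
    (ht : t ∈ Set.Ico (0 : ℝ) 1) (hu : u ∈ Set.Ico (0 : ℝ) 1) {n : ℕ}
    (h : ∀ i < n, radixDigit N t i = radixDigit N u i) :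
    |t - u| ≤ (∏ i ∈ Finset.range n, (N i : ℝ))⁻¹ := by
  have hpos : ∀ i, (0 : ℝ) < N i := fun i => by exact_mod_cast (by have := hN i; omega : 0 < N i)
  -- Equal digits cancel at every step, so the scaled difference is a difference of two remainders
  -- in `[0, 1)`.
  have key : ∀ m ≤ n, (t - u) * ∏ i ∈ Finset.range m, (N i : ℝ) =
      radixRemainder N t m - radixRemainder N u m := by
    intro m hm
    induction m with
    | zero => simp [radixRemainder]
    | succ m ih =>
      have hd := h m (by omega)
      have h1 : ∀ v ∈ Set.Ico (0 : ℝ) 1, radixRemainder N v (m + 1) =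
          N m * radixRemainder N v m - radixDigit N v m := by
        intro v hv
        have h0 := mul_nonneg (hpos m).le (radixRemainder_mem_Ico N hv m).1
        rw [radixRemainder, Int.fract, radixDigit, natCast_floor_eq_intCast_floor h0]
      rw [Finset.prod_range_succ, ← mul_assoc, ih (by omega), h1 t ht, h1 u hu, hd]
      ring
  have hP : 0 < ∏ i ∈ Finset.range n, (N i : ℝ) := Finset.prod_pos fun i _ => hpos i
  rw [← one_div, le_div_iff₀ hP, ← abs_of_pos hP, ← abs_mul, key n le_rfl, abs_le]
  have h1 := radixRemainder_mem_Ico N ht n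
  have h2 := radixRemainder_mem_Ico N hu n
  constructor <;> linarith [h1.1, h1.2, h2.1, h2.2]

theorem eq_of_radixDigit_eq {N : ℕ → ℕ} (hN : ∀ i, 2 ≤ N i) {t u : ℝ}
    (ht : t ∈ Set.Ico (0 : ℝ) 1) (hu : u ∈ Set.Ico (0 : ℝ) 1)
    (h : ∀ i, radixDigit N t i = radixDigit N u i) : t = u := by
  have hle : ∀ n : ℕ, |t - u| ≤ (1 / 2 : ℝ) ^ n := by
    intro n
    refine (abs_sub_le_of_radixDigit_eq hN ht hu (n := n) fun i _ => h i).trans ?_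
    rw [← Finset.prod_inv_distrib]
    calc ∏ i ∈ Finset.range n, ((N i : ℝ))⁻¹ ≤ ∏ _i ∈ Finset.range n, (1 / 2 : ℝ) := by
          refine Finset.prod_le_prod (fun i _ => by positivity) fun i _ => ?_
          rw [one_div]
          exact inv_anti₀ (by norm_num) (by exact_mod_cast hN i)
      _ = (1 / 2 : ℝ) ^ n := by simp
  have h0 : |t - u| ≤ 0 := ge_of_tendsto'
    (tendsto_pow_atTop_nhds_zero_of_lt_one (by norm_num) (by norm_num)) hle
  exact sub_eq_zero.1 (abs_eq_zero.1 (le_antisymm h0 (abs_nonneg _)))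

/-- The constant absorbs `a 0` and the finitely many bad indices. The shift is needed because
separation involves one more digit than the radix estimate. -/
theorem exists_prod_le_mul_prod {a b : ℕ → ℝ} (ha : ∀ i, 0 < a i) (hb : ∀ i, 0 < b i)
    (h : ∀ᶠ i in atTop, a (i + 1) ≤ b i) :
    ∃ C, 0 < C ∧ ∀ n, ∏ i ∈ Finset.range (n + 1), a i ≤ C * ∏ i ∈ Finset.range n, b i := by
  obtain ⟨N, hN⟩ := eventually_atTop.1 h
  set m : ℕ → ℝ := fun i => max 1 (a (i + 1) / b i) with hm
  have hm1 : ∀ i, 1 ≤ m i := fun i => le_max_left _ _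
  have hmono : Monotone fun n => ∏ i ∈ Finset.range n, m i := by
    refine monotone_nat_of_le_succ fun n => ?_
    rw [Finset.prod_range_succ]
    exact le_mul_of_one_le_right (Finset.prod_nonneg fun i _ => by linarith [hm1 i]) (hm1 n)
  have hconst : ∀ k, ∏ i ∈ Finset.range (N + k), m i = ∏ i ∈ Finset.range N, m i := by
    intro k
    induction k with
    | zero => rfl
    | succ k ih =>
      rw [← add_assoc, Finset.prod_range_succ, ih, hm]
      simp only
      rw [max_eq_left ((div_le_one (hb _)).2 (hN _ (by omega))), mul_one]
  refine ⟨(∏ i ∈ Finset.range N, m i) * a 0,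
    mul_pos (Finset.prod_pos fun i _ => by linarith [hm1 i]) (ha 0), fun n => ?_⟩
  rw [Finset.prod_range_succ']
  calc (∏ i ∈ Finset.range n, a (i + 1)) * a 0
      ≤ (∏ i ∈ Finset.range n, m i * b i) * a 0 := by
        refine mul_le_mul_of_nonneg_right (Finset.prod_le_prod (fun i _ => (ha _).le) fun i _ => ?_)
          (ha 0).le
        rw [← div_le_iff₀ (hb i)]
        exact le_max_right _ _
    _ = (∏ i ∈ Finset.range n, m i) * (∏ i ∈ Finset.range n, b i) * a 0 := by
        rw [Finset.prod_mul_distrib]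
    _ ≤ (∏ i ∈ Finset.range N, m i) * (∏ i ∈ Finset.range n, b i) * a 0 := by
        refine mul_le_mul_of_nonneg_right (mul_le_mul_of_nonneg_right ?_
          (Finset.prod_nonneg fun i _ => (hb i).le)) (ha 0).le
        rw [← hconst n]
        exact hmono (by omega)
    _ = _ := by ring

theorem tendsto_nat_mul_exp_neg_rpow (C : ℝ) {b γ : ℝ} (hb : 0 < b) (hγ : 0 < γ) :
    Tendsto (fun n : ℕ => C * ((n : ℝ) * Real.exp (-b * (n : ℝ) ^ γ))) atTop (𝓝 0) := by
  have h1 : Tendsto (fun n : ℕ => (n : ℝ) ^ γ) atTop atTop :=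
    (tendsto_rpow_atTop hγ).comp tendsto_natCast_atTop_atTop
  have h2 := ((tendsto_rpow_mul_exp_neg_mul_atTop_nhds_zero γ⁻¹ b hb).comp h1).const_mul C
  rw [mul_zero] at h2
  refine h2.congr fun n => ?_
  simp only [Function.comp]
  rw [Real.rpow_rpow_inv (Nat.cast_nonneg n) hγ.ne']

/-! ### The Cantor set and the lower bound -/

/-- The number of admissible values for the digit of index `i`. -/
noncomputable def digitRange (θ γ : ℝ) (i : ℕ) : ℕ := ⌈Real.exp (θ * ((i : ℝ) + 1) ^ γ)⌉₊

/-- The digits of the points of the Cantor set, parametrised by `t ∈ [0, 1)`. -/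
noncomputable def cantorDigit (θ γ t : ℝ) (i : ℕ) : ℕ :=
  ⌊Real.exp (((i + 1 : ℕ) : ℝ) ^ γ)⌋₊ - ⌊Real.exp ((i : ℝ) ^ γ)⌋₊ + 2 +
    radixDigit (digitRange θ γ) t i

theorem two_le_digitRange {θ : ℝ} (hθ : 0 < θ) (γ : ℝ) (i : ℕ) : 2 ≤ digitRange θ γ i := by
  have h : 1 < Real.exp (θ * ((i : ℝ) + 1) ^ γ) := Real.one_lt_exp_iff.2 (by positivity)
  have := Nat.lt_ceil.2 (show ((1 : ℕ) : ℝ) < Real.exp (θ * ((i : ℝ) + 1) ^ γ) by exact_mod_cast h)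
  exact this

theorem digitRange_le (θ γ : ℝ) (i : ℕ) :
    (digitRange θ γ i : ℝ) ≤ Real.exp (θ * ((i : ℝ) + 1) ^ γ) + 1 :=
  (Nat.ceil_lt_add_one (Real.exp_pos _).le).le

theorem two_le_cantorDigit (θ γ t : ℝ) (i : ℕ) : 2 ≤ cantorDigit θ γ t i := by
  unfold cantorDigit
  omega

theorem cantorDigit_add_one_le {θ γ t : ℝ} (hθ : 0 < θ) (hθ1 : θ ≤ 1)
    (ht : t ∈ Set.Ico (0 : ℝ) 1) (i : ℕ) :
    (cantorDigit θ γ t i : ℝ) + 1 ≤ 6 * Real.exp (((i : ℝ) + 1) ^ γ) := by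
  have h1 : radixDigit (digitRange θ γ) t i + 1 ≤ digitRange θ γ i :=
    radixDigit_lt (two_le_digitRange hθ γ) ht i
  have h2 : ((radixDigit (digitRange θ γ) t i : ℝ)) + 1 ≤ digitRange θ γ i := by exact_mod_cast h1
  have h3 := digitRange_le θ γ i
  have h4 : Real.exp (θ * ((i : ℝ) + 1) ^ γ) ≤ Real.exp (((i : ℝ) + 1) ^ γ) :=
    Real.exp_le_exp.2 (mul_le_of_le_one_left (by positivity) hθ1)
  have h5 : (⌊Real.exp (((i + 1 : ℕ) : ℝ) ^ γ)⌋₊ : ℝ) ≤ Real.exp (((i : ℝ) + 1) ^ γ) := by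
    refine (Nat.floor_le (Real.exp_pos _).le).trans_eq ?_
    push_cast
    rfl
  have h6 : ((⌊Real.exp (((i + 1 : ℕ) : ℝ) ^ γ)⌋₊ - ⌊Real.exp ((i : ℝ) ^ γ)⌋₊ : ℕ) : ℝ) ≤
      ⌊Real.exp (((i + 1 : ℕ) : ℝ) ^ γ)⌋₊ := by exact_mod_cast Nat.sub_le _ _
  have h7 : 1 ≤ Real.exp (((i : ℝ) + 1) ^ γ) := Real.one_le_exp (by positivity)
  unfold cantorDigit
  push_cast at h5 h6 ⊢
  linarith

/-- The floors telescope; the `1` on the left is `⌊exp (0 ^ γ)⌋₊`. -/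
theorem sum_cantorDigit {γ : ℝ} (hγ : 0 < γ) (θ t : ℝ) (n : ℕ) :
    ∑ i ∈ Finset.range n, cantorDigit θ γ t i + 1 = ⌊Real.exp ((n : ℝ) ^ γ)⌋₊ + 2 * n +
      ∑ i ∈ Finset.range n, radixDigit (digitRange θ γ) t i := by
  induction n with
  | zero =>
    rw [Nat.cast_zero, Real.zero_rpow hγ.ne', Real.exp_zero, Nat.floor_one]
    simp
  | succ n ih =>
    have hmono : ⌊Real.exp ((n : ℝ) ^ γ)⌋₊ ≤ ⌊Real.exp (((n + 1 : ℕ) : ℝ) ^ γ)⌋₊ := by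
      refine Nat.floor_mono (Real.exp_le_exp.2 (Real.rpow_le_rpow (by positivity) ?_ hγ.le))
      exact_mod_cast Nat.le_succ n
    rw [Finset.sum_range_succ, Finset.sum_range_succ (fun i => radixDigit _ _ _)]
    have hd : cantorDigit θ γ t n = ⌊Real.exp (((n + 1 : ℕ) : ℝ) ^ γ)⌋₊ -
        ⌊Real.exp ((n : ℝ) ^ γ)⌋₊ + 2 + radixDigit (digitRange θ γ) t n := rfl
    omega

theorem sumPartialQuotients_eq_sum_range (x : ℝ) (n : ℕ) :
    sumPartialQuotients x n = ∑ i ∈ Finset.range n, partialQuotient x (i + 1) := by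
  simpa [sumPartialQuotients] using sumPartialQuotients_add x 0 n

theorem mem_growthSet_of_partialQuotient_eq_cantorDigit {θ γ t x : ℝ} (hγ : 0 < γ) (hθ : 0 < θ)
    (hθ1 : θ < 1) (ht : t ∈ Set.Ico (0 : ℝ) 1) (hx : x ∈ unitIrrationals)
    (h : ∀ i, partialQuotient x (i + 1) = cantorDigit θ γ t i) :
    x ∈ growthSet fun n : ℕ => Real.exp ((n : ℝ) ^ γ) := by
  refine ⟨hx.1, hx.2, ?_⟩
  rw [← tendsto_sub_nhds_zero_iff]
  -- The rounding, the added `2`s and the free digits total `O(n * exp (θ * n ^ γ))`; the constant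
  -- `6` is generous.
  refine squeeze_zero_norm' ?_ (tendsto_nat_mul_exp_neg_rpow 6 (sub_pos.2 hθ1) hγ)
  filter_upwards [eventually_ge_atTop 1] with n hn
  have hn1 : (1 : ℝ) ≤ n := by exact_mod_cast hn
  set φ := Real.exp ((n : ℝ) ^ γ) with hφ
  have hφ0 : 0 < φ := Real.exp_pos _
  set E := Real.exp (θ * (n : ℝ) ^ γ) with hE
  have hE1 : 1 ≤ E := Real.one_le_exp (by positivity)
  set R := ∑ i ∈ Finset.range n, radixDigit (digitRange θ γ) t i with hR
  have hRle : (R : ℝ) ≤ n * E := by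
    rw [hR, Nat.cast_sum]
    refine (Finset.sum_le_card_nsmul _ _ E fun i hi => ?_).trans_eq (by simp)
    have h1 : radixDigit (digitRange θ γ) t i + 1 ≤ digitRange θ γ i :=
      radixDigit_lt (two_le_digitRange hθ γ) ht i
    have h2 : (radixDigit (digitRange θ γ) t i : ℝ) + 1 ≤ digitRange θ γ i := by exact_mod_cast h1
    have h3 := digitRange_le θ γ i
    have h4 : Real.exp (θ * ((i : ℝ) + 1) ^ γ) ≤ E := by
      refine Real.exp_le_exp.2 (mul_le_mul_of_nonneg_left
        (Real.rpow_le_rpow (by positivity) ?_ hγ.le) hθ.le)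
      exact_mod_cast Finset.mem_range.1 hi
    linarith
  have hS : sumPartialQuotients x n + 1 = ⌊φ⌋₊ + 2 * n + R := by
    rw [sumPartialQuotients_eq_sum_range, Finset.sum_congr rfl fun i _ => h i]
    exact sum_cantorDigit hγ θ t n
  have hS' : (sumPartialQuotients x n : ℝ) + 1 = ⌊φ⌋₊ + 2 * n + R := by exact_mod_cast hS
  have hf1 := Nat.floor_le hφ0.le
  have hf2 := Nat.lt_floor_add_one φ
  have hR0 : (0 : ℝ) ≤ R := Nat.cast_nonneg R
  have hnE : (n : ℝ) ≤ n * E := le_mul_of_one_le_right (by linarith) hE1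
  have hexp : Real.exp (-(1 - θ) * (n : ℝ) ^ γ) = E / φ := by
    rw [hE, hφ, ← Real.exp_sub]
    congr 1
    ring
  rw [Real.norm_eq_abs, hexp, div_sub_one hφ0.ne', abs_div, abs_of_pos hφ0, ← mul_div_assoc,
    ← mul_div_assoc]
  refine div_le_div_of_nonneg_right (abs_le.2 ⟨?_, ?_⟩) hφ0.le <;> linarith

theorem eventually_rpow_le_digitRange {θ γ r : ℝ} (hγ : 0 < γ) (hγ1 : γ ≤ 1) (hr : 0 < r)
    (hrθ : 2 * r < θ) :
    ∀ᶠ i : ℕ in atTop, (6 * Real.exp ((((i + 1 : ℕ) : ℝ) + 1) ^ γ)) ^ (2 * r) ≤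
      (digitRange θ γ i : ℝ) := by
  have h1 : Tendsto (fun n : ℕ => (θ - 2 * r) * (((n + 1 : ℕ) : ℝ)) ^ γ) atTop atTop :=
    Tendsto.const_mul_atTop (sub_pos.2 hrθ) ((tendsto_rpow_atTop hγ).comp
      (tendsto_natCast_atTop_atTop.comp (tendsto_add_atTop_nat 1)))
  filter_upwards [h1.eventually_ge_atTop (2 * r * (Real.log 6 + 1))] with i hi
  refine le_trans ?_ (Nat.le_ceil _)
  -- Subadditivity for `γ ≤ 1` makes the index shift cost only a bounded factor, which the gap `θ -
  -- 2 * r` overcomes.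
  have h2 : (((i + 1 : ℕ) : ℝ) + 1) ^ γ ≤ ((i + 1 : ℕ) : ℝ) ^ γ + 1 := by
    have := Real.rpow_add_le_add_rpow (Nat.cast_nonneg (i + 1)) zero_le_one hγ.le hγ1
    simpa using this
  rw [Real.rpow_def_of_pos (by positivity), Real.log_mul (by norm_num) (Real.exp_pos _).ne',
    Real.log_exp]
  refine Real.exp_le_exp.2 ?_
  have h3 := mul_le_mul_of_nonneg_left h2 (by linarith : (0 : ℝ) ≤ 2 * r)
  have h4 : ((i + 1 : ℕ) : ℝ) ^ γ = ((i : ℝ) + 1) ^ γ := by push_cast; rfl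
  rw [h4] at h3 hi
  linarith

theorem le_dimH_growthSet {γ : ℝ} (hγ : 0 < γ) (hγ1 : γ ≤ 1) {r : NNReal} (hr : 0 < r)
    (hr2 : r < 1 / 2) : (r : ENNReal) ≤ dimH (growthSet fun n : ℕ => Real.exp ((n : ℝ) ^ γ)) := by
  have hr' : (0 : ℝ) < r := by exact_mod_cast hr
  have hr2' : (r : ℝ) < 1 / 2 := by exact_mod_cast hr2
  -- The midpoint of `2 * r` and `1`: above `2 * r` for the Hölder bound, below `1` for negligible
  -- free digits.
  set θ : ℝ := r + 1 / 2 with hθdef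
  have hθ : 0 < θ := by linarith
  have hθ1 : θ < 1 := by linarith
  have hN := two_le_digitRange hθ γ
  choose g hgU hg using fun t : ℝ =>
    exists_unitIrrationals_partialQuotient_eq (two_le_cantorDigit θ γ t)
  set A : ℕ → ℝ := fun i => 6 * Real.exp (((i : ℝ) + 1) ^ γ) with hA
  have hA0 : ∀ i, 0 < A i := fun i => by positivity
  obtain ⟨C, hC, hprod⟩ := exists_prod_le_mul_prod (a := fun i => A i ^ (2 * (r : ℝ)))
    (b := fun i => (digitRange θ γ i : ℝ)) (fun i => by have := hA0 i; positivity)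
    (fun i => by have := hN i; positivity)
    (eventually_rpow_le_digitRange hγ hγ1 hr' (by linarith))
  have hbound : ∀ t ∈ Set.Ico (0 : ℝ) 1, ∀ u ∈ Set.Ico (0 : ℝ) 1,
      |t - u| ≤ (C * 2 ^ (r : ℝ)) * |g t - g u| ^ (r : ℝ) := by
    intro t ht u hu
    by_cases heq : ∀ i, radixDigit (digitRange θ γ) t i = radixDigit (digitRange θ γ) u i
    · rw [eq_of_radixDigit_eq hN ht hu heq, sub_self, abs_zero]
      positivity
    push Not at heq
    classical
    set n := Nat.find heq with hn
    have hne := Nat.find_spec heq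
    have hlt : ∀ i < n, radixDigit (digitRange θ γ) t i = radixDigit (digitRange θ γ) u i :=
      fun i hi => not_not.1 (Nat.find_min heq hi)
    have hsep := prod_le_abs_sub_of_partialQuotient_ne (hgU t) (hgU u) (A := A) (n := n)
      (fun i => by rw [hg]; exact two_le_cantorDigit _ _ _ _)
      (fun i => by rw [hg]; exact two_le_cantorDigit _ _ _ _)
      (fun i => by rw [hg]; exact cantorDigit_add_one_le hθ hθ1.le ht i)
      (fun i => by rw [hg]; exact cantorDigit_add_one_le hθ hθ1.le hu i)
      (fun i hi => by rw [hg, hg, cantorDigit, cantorDigit, hlt i hi])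
      (by rw [hg, hg, cantorDigit, cantorDigit]; exact fun h => hne (Nat.add_left_cancel h))
    have hP : 0 < ∏ i ∈ Finset.range (n + 1), A i := Finset.prod_pos fun i _ => hA0 i
    have hQ : 0 < ∏ i ∈ Finset.range n, (digitRange θ γ i : ℝ) :=
      Finset.prod_pos fun i _ => by have := hN i; positivity
    have hpr := hprod n
    rw [Real.finsetProd_rpow _ _ fun i _ => (hA0 i).le] at hpr
    have hsep' := Real.rpow_le_rpow (by rw [Finset.prod_inv_distrib, Finset.prod_pow]; positivity)
      hsep hr'.le
    calc |t - u| ≤ (∏ i ∈ Finset.range n, (digitRange θ γ i : ℝ))⁻¹ :=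
          abs_sub_le_of_radixDigit_eq hN ht hu hlt
      _ ≤ C * ((∏ i ∈ Finset.range (n + 1), A i) ^ (2 * (r : ℝ)))⁻¹ := by
          rw [← div_eq_mul_inv, le_div_iff₀ (by positivity), inv_mul_eq_div, div_le_iff₀ hQ]
          exact hpr
      _ = (C * 2 ^ (r : ℝ)) *
          (1 / 2 * ∏ i ∈ Finset.range (n + 1), (A i ^ 2)⁻¹) ^ (r : ℝ) := by
          rw [Finset.prod_inv_distrib, Finset.prod_pow,
            Real.mul_rpow (by norm_num) (by positivity), Real.inv_rpow (by positivity),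
            Real.rpow_mul hP.le, Real.rpow_two, one_div, Real.inv_rpow (by norm_num)]
          field_simp
      _ ≤ _ := by gcongr
  have hdim := mul_dimH_le_dimH_image (g := g) (S := Set.Ico (0 : ℝ) 1)
    (C := ⟨C * 2 ^ (r : ℝ), by positivity⟩) hr hbound
  rw [Real.dimH_of_nonempty_interior (by rw [interior_Ico]; exact ⟨1 / 2, by norm_num⟩),
    Module.finrank_self, Nat.cast_one, mul_one] at hdim
  refine hdim.trans (dimH_mono ?_)
  rintro _ ⟨t, ht, rfl⟩
  exact mem_growthSet_of_partialQuotient_eq_cantorDigit hγ hθ hθ1 ht (hgU t) (hg t)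

theorem theorem1p1 (γ : ℝ) (hγ : γ ∈ Set.Ico (1 / 2 : ℝ) 1) :
    dimH (growthSet fun n : ℕ => Real.exp ((n : ℝ) ^ γ)) = 1 / 2 := by
  refine le_antisymm (dimH_growthSet_le hγ.1) (le_of_forall_lt fun a ha => ?_)
  obtain ⟨r, har, hr⟩ := ENNReal.lt_iff_exists_nnreal_btwn.1 ha
  have hγ0 : 0 < γ := by linarith [hγ.1]
  refine har.trans_le (le_dimH_growthSet hγ0 hγ.2.le ?_ ?_)
  · exact_mod_cast pos_of_gt har
  · rw [← ENNReal.coe_lt_coe]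
    refine hr.trans_eq ?_
    rw [ENNReal.coe_div (by norm_num)]
    simp
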